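/- A graph $G=(V,E,\omega)$ is a finite directed graph (loops allowed) with real edge weights; its adjacency matrix $A=\mathcal A(G)$ has $A_{ij}=\omega(e_{ij})$ if there is an edge $e_{ij}$ from $v_j$ to $v_i$, and $A_{ij}=0$ otherwise. $\sigma(G)$ is the set of complex eigenvalues of $\mathcal A(G)$, and $(\lambda,\mathbf x)$ with $\mathbf x\in\mathbb C^V$ nonzero is an eigenpair of $G$ if $\mathcal A(G)\mathbf x=\lambda\mathbf x$. For $S\subseteq V$, $G|_S$ is the induced subgraph and $\mathbf x_S$ the restriction of $\mathbf x$. Let $B\subseteq V$ and $\bar B=V\setminus B$. A component branch is an ordered sequence $\beta=\{v_i,e_0,C_1,e_1,C_2,\dots,C_m,e_m,v_j\}$, $m\ge 0$, with $v_i,v_j\in B$ (possibly equal), distinct strongly connected components $C_1,\dots,C_m$ of $G|_{\bar B}$, and edges $e_0$ from $v_i$ to a vertex of $C_1$, $e_k$ from a vertex of $C_k$ to a vertex of $C_{k+1}$ for $1\le k<m$, and $e_m$ from a vertex of $C_m$ to $v_j$ (if $m=0$, $e_0$ is an edge from $v_i$ to $v_j$). It is regarded as the graph formed by $v_i$, $v_j$,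 the $C_k$ and the $e_k$. The specialization $\mathcal S_B(G)$ has as vertices the vertices of $B$ together with a separate copy of each component of each branch, and as edges the edges of all the branches, with the weights they have in $G$; that is, it is the disjoint union of all branches with equal vertices of $B$ identified (every vertex of $B$ being kept). For a strongly connected component $Z$ of $G|_{\bar B}$, $\mathcal C(Z)$ is the set of copies of $Z$ in $\mathcal S_B(G)$; each copy $Z_i$ belongs to one branch $\beta_i$ that contains $Z$. For $Z=C_k$ in $\beta$, put $In(\beta,Z)=\{v_i,e_0,C_1,\dots,e_{k-1},C_k\}$, $Out(\beta,Z)=\{C_k,e_k,C_{k+1},\dots,C_m,e_m,v_j\}$, and $$T(\beta,Z,\lambda)=(\lambda I-\underline C_k)^{-1}Y_{k-1}(\lambda I-\underline C_{k-1})^{-1}Y_{k-2}\cdots(\lambda I-\underline C_1)^{-1}Y_0,$$ where $\underline C_r=\mathcal A(C_r)$ and $Y_r$ is the matrix with columns indexed by the vertices of $C_r$ (of $B$ if $r=0$) and rows by those of $C_{r+1}$ whose only possibly nonzero entry is $\omega(e_r)$ at the position of the edge $e_r$. **Theorem (Eigenvectors of Specialized Graphs).** If $(\lambda,\mathbf u)$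 is an eigenpair of $G$ with $\lambda\notin\sigma(G|_{\bar B})$, then there is an eigenpair $(\lambda,\mathbf v)$ of $\mathcal S_B(G)$ such that $\mathbf u_B=\mathbf v_B$ and, for every strongly connected component $Z$ of $G|_{\bar B}$, the following hold. (1) For every $Z_i\in\mathcal C(Z)$, with branch $\beta_i$, $\mathbf v_{Z_i}=T(\beta_i,Z,\lambda)\,\mathbf v_B$. Hence $\mathbf v_{Z_i}=\mathbf v_{Z_j}$ whenever $Z_i,Z_j\in\mathcal C(Z)$ have the same incoming branch, $In(\beta_i,Z)=In(\beta_j,Z)$. (2) For every $Z_i\in\mathcal C(Z)$, if $Z_{1},\dots,Z_{\ell}$ are the copies of $Z$ that have the same outgoing branch as $Z_i$ (that is, $Out(\beta_k,Z)=Out(\beta_i,Z)$), then $$\mathbf u_Z=\sum_{k=1}^{\ell}\mathbf v_{Z_k}=\sum_{k=1}^{\ell}T(\beta_k,Z,\lambda)\,\mathbf v_B .$$ -/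

import Mathlib

open scoped Classical

/-- A weighted directed graph with real edge weights (loops allowed). `Adj x y` means that there is
an edge that begins at `x` and ends at `y`, and `weight x y` is the weight of that edge; values of
`weight` at pairs that are not edges are never used. -/
structure WDigraph (V : Type*) extends Digraph V where
  weight : V → V → ℝ

namespace WDigraph

section Basic

variable {V : Type*}

/-- The weighted adjacency matrix: the entry `(i, j)` is the weight of the edge from `j` to `i`,
and `0` if there is no such edge. -/
noncomputable def adjMatrix (G : WDigraph V) : Matrix V V ℝ :=
  Matrix.of fun i j => if G.Adj j i then G.weight j i else 0

/-- The weighted adjacency matrix, regarded as a complex matrix. -/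
noncomputable def adjMatrixC (G : WDigraph V) : Matrix V V ℂ :=
  G.adjMatrix.map Complex.ofReal

/-- The spectrum: the multiset of complex eigenvalues of the adjacency matrix. -/
noncomputable def spectrum [Fintype V] (G : WDigraph V) : Multiset ℂ :=
  G.adjMatrixC.charpoly.roots

/-- `(μ, x)` is an eigenpair of `G`. -/
def IsEigenpair [Fintype V] (G : WDigraph V) (μ : ℂ) (x : V → ℂ) : Prop :=
  x ≠ 0 ∧ G.adjMatrixC.mulVec x = μ • x

/-- The restriction of `G` to a vertex set `S`. -/
def restrict (G : WDigraph V) (S : Set V) : WDigraph S where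
  Adj x y := G.Adj x y
  weight x y := G.weight x y

/-- Mutual reachability: there are directed paths from `x` to `y` and from `y` to `x`. -/
def mutualReach (G : WDigraph V) : Setoid V where
  r x y := Relation.ReflTransGen G.Adj x y ∧ Relation.ReflTransGen G.Adj y x
  iseqv := ⟨fun _ => ⟨.refl, .refl⟩, fun h => ⟨h.2, h.1⟩,
    fun h k => ⟨h.1.trans k.1, k.2.trans h.2⟩⟩

/-- The strongly connected components of `G`: the classes of mutual reachability. -/
def StrongComponent (G : WDigraph V) : Type _ := Quotient G.mutualReach

instance [Finite V] (G : WDigraph V) : Finite G.StrongComponent :=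
  inferInstanceAs (Finite (Quotient G.mutualReach))

end Basic

section Specialization

variable {V : Type*} (G : WDigraph V) (B : Set V)

/-- The strongly connected components of the restriction of `G` to the complement of `B`. -/
abbrev Component : Type _ := (G.restrict Bᶜ).StrongComponent

variable {G B}

/-- The vertex set, inside `V`, of a component. -/
def Component.verts (C : Component G B) : Set V :=
  {x | ∃ h : x ∈ Bᶜ, Quotient.mk (G.restrict Bᶜ).mutualReach ⟨x, h⟩ = C}

variable (G B)

/-- `e = (x, y)` is an edge of `G` from a vertex in `S` to a vertex in `T`. -/
def IsEdgeFromTo (e : V × V) (S T : Set V) : Prop :=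
  G.Adj e.1 e.2 ∧ e.1 ∈ S ∧ e.2 ∈ T

/-- For steps `(e₀, C₁), (e₁, C₂), …, (eₘ₋₁, Cₘ)` and a last edge `eₘ`: the edge `e₀` leads from `S`
to `C₁`, each `eₖ` leads from `Cₖ` to `Cₖ₊₁`, and `eₘ` leads from `Cₘ` to `T`
(from `S` to `T` if `m = 0`). -/
def IsRoute : Set V → List ((V × V) × Component G B) → V × V → Set V → Prop
  | S, [], e, T => G.IsEdgeFromTo e S T
  | S, (f, C) :: l, e, T => G.IsEdgeFromTo f S C.verts ∧ IsRoute C.verts l e T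

/-- A component branch `{vᵢ, e₀, C₁, e₁, C₂, …, Cₘ, eₘ, vⱼ}` of `G` with respect to `B`, `m ≥ 0`: a
path or cycle of components that begins and ends in `B`. The list `steps` is
`[(e₀, C₁), (e₁, C₂), …, (eₘ₋₁, Cₘ)]`, and `exitEdge` is `eₘ`. As in any path, the `Cₖ` are
distinct. -/
@[ext]
structure ComponentBranch where
  first : B
  steps : List ((V × V) × Component G B)
  exitEdge : V × V
  last : B
  isRoute : G.IsRoute B {(first : V)} steps exitEdge {(last : V)}
  nodup : (steps.map Prod.snd).Nodup

variable {G B}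

namespace ComponentBranch

/-- The components `C₁, …, Cₘ` of a branch. -/
def comps (β : ComponentBranch G B) : List (Component G B) := β.steps.map Prod.snd

/-- The edges `e₀, …, eₘ` of a branch. -/
def edges (β : ComponentBranch G B) : List (V × V) := β.steps.map Prod.fst ++ [β.exitEdge]

/-- The edges of a branch, regarded as a subgraph of `G`: the edges `e₀, …, eₘ` and all the edges
inside the components `C₁, …, Cₘ`. -/
def Adj (β : ComponentBranch G B) (x y : V) : Prop :=
  (x, y) ∈ β.edges ∨ ∃ C ∈ β.comps, x ∈ C.verts ∧ y ∈ C.verts ∧ G.Adj x y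

/-- The (zero-based) position of the component `Z` in the branch. -/
noncomputable def pos (β : ComponentBranch G B) (Z : Component G B) : ℕ := β.comps.idxOf Z

/-- The incoming branch `{vᵢ, e₀, C₁, …, Z}` of `β` up to `Z`. -/
noncomputable def incoming (β : ComponentBranch G B) (Z : Component G B) :
    B × List ((V × V) × Component G B) :=
  (β.first, β.steps.take (β.pos Z + 1))

/-- The outgoing branch `{Z, eₖ, Cₖ₊₁, …, Cₘ, eₘ, vⱼ}` in `β` from `Z = Cₖ`. -/
noncomputable def outgoing (β : ComponentBranch G B) (Z : Component G B) :
    Component G B × List ((V × V) × Component G B) × (V × V) × B :=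
  (Z, β.steps.drop (β.pos Z + 1), β.exitEdge, β.last)

theorem pos_lt (β : ComponentBranch G B) {Z : Component G B} (hZ : Z ∈ β.comps) :
    β.pos Z < β.steps.length := by
  simpa [pos, comps] using List.idxOf_lt_length_iff.2 hZ

/-- The edge of `β` through which the branch enters its component `Z`. -/
noncomputable def entryEdge (β : ComponentBranch G B) (Z : Component G B) (hZ : Z ∈ β.comps) :
    V × V :=
  (β.steps[β.pos Z]'(β.pos_lt hZ)).1

end ComponentBranch

instance [Finite V] : Finite (ComponentBranch G B) := by
  let φ : ComponentBranch G B →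
      B × {l : List ((V × V) × Component G B) // l.Nodup} × (V × V) × B :=
    fun β => (β.first, ⟨β.steps, List.Nodup.of_map _ β.nodup⟩, β.exitEdge, β.last)
  have : Fintype ((V × V) × Component G B) := Fintype.ofFinite _
  refine Finite.of_injective φ fun β γ h => ?_
  simp only [φ, Prod.mk.injEq, Subtype.mk.injEq] at h
  exact ComponentBranch.ext h.1 h.2.1 h.2.2.1 h.2.2.2

variable (G B) in
/-- The vertices of the specialized graph: the vertices of `B`, and for each branch `β` its own copy
of every vertex of every component of `β`. -/
abbrev SpecVertex : Type _ :=
  B ⊕ {p : ComponentBranch G B × V // ∃ C ∈ p.1.comps, p.2 ∈ C.verts}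

noncomputable instance [Finite V] : Fintype (SpecVertex G B) := Fintype.ofFinite _

/-- The vertex of `G` of which a vertex of the specialized graph is a copy. -/
def SpecVertex.orig : SpecVertex G B → V
  | .inl b => b
  | .inr p => p.1.2

/-- A vertex of the specialized graph may be an endpoint of edges coming from the branch `β` if it
belongs to `B` (whose vertices are shared by all branches) or to the copies belonging to `β`. -/
def SpecVertex.LiesOn (β : ComponentBranch G B) : SpecVertex G B → Prop
  | .inl _ => True
  | .inr p => p.1.1 = β

variable (G B) in
/-- The specialization of `G` over the base `B`: all component branches, merged along `B`. Edges
inherit their weights from `G`. -/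
def specialization : WDigraph (SpecVertex G B) where
  Adj x y := ∃ β : ComponentBranch G B, x.LiesOn β ∧ y.LiesOn β ∧ β.Adj x.orig y.orig
  weight x y := G.weight x.orig y.orig

/-- The set of copies of the component `Z` in the specialization of `G` over `B`; each copy is given
by the branch that contains it. -/
abbrev Copy (Z : Component G B) : Type _ := {β : ComponentBranch G B // Z ∈ β.comps}

noncomputable instance [Finite V] (Z : Component G B) : Fintype (Copy Z) := Fintype.ofFinite _

/-- The vertex of the copy `Zᵢ` of `Z` that corresponds to the vertex `x` of `Z`. -/
def Copy.vertex {Z : Component G B} (Zi : Copy Z) (x : Z.verts) : SpecVertex G B :=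
  .inr ⟨(Zi.1, x), Z, Zi.2, x.2⟩

variable (G) in
/-- The block of an adjacency matrix, with rows indexed by `T` and columns by `S`, whose only edge
is the edge `e` from `S` to `T`. -/
noncomputable def edgeBlock (S T : Set V) (e : V × V) : Matrix T S ℂ :=
  Matrix.of fun i j => if ((j : V), (i : V)) = e then (G.weight e.1 e.2 : ℂ) else 0

/-- The matrix `(μ I - C)⁻¹` for (the adjacency matrix of) a component `C`. -/
noncomputable def Component.resolvent [Fintype V] (μ : ℂ) (C : Component G B) :
    Matrix C.verts C.verts ℂ :=
  (μ • (1 : Matrix C.verts C.verts ℂ) - (G.restrict C.verts).adjMatrixC)⁻¹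

/-- The product `(μ I - Cₖ)⁻¹ Yₖ₋₁ (μ I - Cₖ₋₁)⁻¹ Yₖ₋₂ ⋯ (μ I - C₁)⁻¹ Y₀`, where `Yᵢ` is the block
of the edge `eᵢ`. The arguments are the steps `(eₖ₋₂, Cₖ₋₁), …, (e₀, C₁)` in reversed order, the
edge `eₖ₋₁` and the component `Cₖ`. -/
noncomputable def transferProd [Fintype V] (μ : ℂ) :
    List ((V × V) × Component G B) → V × V → (C : Component G B) → Matrix C.verts B ℂ
  | [], e, C => C.resolvent μ * G.edgeBlock B C.verts e
  | (f, D) :: l, e, C => C.resolvent μ * G.edgeBlock D.verts C.verts e * transferProd μ l f D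

/-- The eigenvector transfer matrix `T(β, Z, μ)` of the incoming branch of `β` up to `Z`. -/
noncomputable def ComponentBranch.transferMatrix [Fintype V] (β : ComponentBranch G B)
    (Z : Component G B) (hZ : Z ∈ β.comps) (μ : ℂ) : Matrix Z.verts B ℂ :=
  transferProd μ (β.steps.take (β.pos Z)).reverse (β.entryEdge Z hZ) Z

end Specialization

end WDigraph

/-! On a component `Z` the eigenvector equation of `G` reads `(μI - Z) u_Z = Y u_B + ∑ Y_D u_D`, the
sum running over the components `D ≠ Z` and the blocks `Y`, `Y_D` collecting the edges into `Z` from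
`B` and `D`. The resolvent of `Z` exists because `μI - A(G|_B̄)` is block triangular along
reachability (`Component.isUnit_det`). Only components strictly before `Z` contribute, so
well-founded induction unrolls `u_Z` into the sum, over all routes from `B` to `Z`, of transfer
products applied to `u_B` (`InRoute.sum_vec`).

Once an outgoing branch from `Z` is fixed, prepending routes into `Z` gives exactly the copies of
`Z` with that outgoing branch; reachability keeps the components distinct. This is (2), via
`sum_outgoing_eq_sum_inRoute`.

The vector `v` is `u` on `B` and is given on copies by the transfer matrices, so (1) is built in. It
is an eigenvector: a copy is entered by a single edge, and applying `μI - Z` cancels the leading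
resolvent (`sum_adjMatrixC_vertex`); at a base vertex `b`, an edge `x → b` of `G` with `x` in `Z`
reappears once for each copy of `Z` whose outgoing branch is that edge, and these copies add up to
`u x` (`sum_adjMatrixC_inl`). Finally `u_B = 0` would force `u = 0`, so `v ≠ 0`. -/

namespace WDigraph

section TransferVectors

variable {V : Type*} {G : WDigraph V} {B : Set V}

/-! ### The order of the components by reachability -/

namespace Component

/-- The component containing a vertex outside the base. -/
def of (G : WDigraph V) {B : Set V} (x : (Bᶜ : Set V)) : Component G B :=
  Quotient.mk (G.restrict Bᶜ).mutualReach x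

theorem mem_verts_of (x : (Bᶜ : Set V)) : (x : V) ∈ (of G x).verts := ⟨x.2, rfl⟩

theorem of_eq {C : Component G B} {x : V} (hx : x ∈ C.verts) : of G ⟨x, hx.1⟩ = C := hx.2

theorem eq_of_mem_verts {C D : Component G B} {x : V} (hC : x ∈ C.verts) (hD : x ∈ D.verts) :
    C = D := (of_eq hC).symm.trans (of_eq hD)

/-- Components are ordered by reachability outside the base. -/
instance : PartialOrder (Component G B) where
  le C D := ∃ x y : (Bᶜ : Set V), of G x = C ∧ of G y = D ∧
    Relation.ReflTransGen (G.restrict Bᶜ).Adj x y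
  le_refl C := by
    obtain ⟨x, rfl⟩ := Quotient.exists_rep C
    exact ⟨x, x, rfl, rfl, .refl⟩
  le_trans := by
    rintro _ _ _ ⟨x, y, rfl, rfl, hxy⟩ ⟨y', z, hy, rfl, hyz⟩
    have h : (G.restrict Bᶜ).mutualReach y' y := Quotient.exact hy
    exact ⟨x, z, rfl, rfl, (hxy.trans h.2).trans hyz⟩
  le_antisymm := by
    rintro _ _ ⟨x, y, rfl, rfl, hxy⟩ ⟨y', x', hy, hx, hyx⟩
    have h : (G.restrict Bᶜ).mutualReach y' y := Quotient.exact hy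
    have k : (G.restrict Bᶜ).mutualReach x' x := Quotient.exact hx
    exact Quotient.sound ⟨hxy, (h.2.trans hyx).trans k.1⟩

theorem le_of_isEdgeFromTo {C D : Component G B} {e : V × V}
    (h : G.IsEdgeFromTo e C.verts D.verts) : C ≤ D :=
  ⟨⟨e.1, h.2.1.1⟩, ⟨e.2, h.2.2.1⟩, of_eq h.2.1, of_eq h.2.2, .single h.1⟩

end Component

/-! ### Block decomposition and resolvents -/

theorem sum_eq_sum_base_add_sum_component [Fintype V] [Fintype (Component G B)] {M : Type*}
    [AddCommMonoid M] (f : V → M) :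
    ∑ x, f x = ∑ b : B, f b + ∑ C : Component G B, ∑ x : C.verts, f x := by
  have h1 : ∑ x, f x = ∑ b : B, f b + ∑ x : (Bᶜ : Set V), f x := by
    rw [← Fintype.sum_subtype_add_sum_subtype (· ∈ B) f]
    congr 1
  rw [h1]
  congr 1
  rw [← Fintype.sum_sigma' (fun (C : Component G B) (x : C.verts) => f x)]
  refine (Fintype.sum_bijective
    (fun p : (C : Component G B) × C.verts => (⟨p.2, p.2.2.1⟩ : (Bᶜ : Set V))) ⟨?_, ?_⟩ _ _
    fun _ => rfl).symm
  · rintro ⟨C, x, hx⟩ ⟨D, y, hy⟩ h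
    simp only [Subtype.mk.injEq] at h
    subst h
    obtain rfl := Component.eq_of_mem_verts hx hy
    rfl
  · exact fun x => ⟨⟨Component.of G x, x, Component.mem_verts_of x⟩, rfl⟩

theorem isUnit_det_of_notMem_spectrum [Fintype V] (G : WDigraph V) {μ : ℂ}
    (hμ : μ ∉ G.spectrum) : IsUnit (μ • (1 : Matrix V V ℂ) - G.adjMatrixC).det := by
  rw [isUnit_iff_ne_zero]
  intro h
  refine hμ ((Polynomial.mem_roots (Matrix.charpoly_monic _).ne_zero).2 ?_)
  rw [Polynomial.IsRoot, Matrix.eval_charpoly, ← h]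
  congr 1
  ext i j
  simp [Matrix.one_apply, Matrix.diagonal_apply]

/-- Sorted by a linear extension of reachability, `μI - A(G|_B̄)` is block triangular, so its
nonzero determinant is the product of those of its component blocks. -/
theorem Component.isUnit_det [Fintype V] {μ : ℂ} (hμ : μ ∉ (G.restrict Bᶜ).spectrum)
    (C : Component G B) :
    IsUnit (μ • (1 : Matrix C.verts C.verts ℂ) - (G.restrict C.verts).adjMatrixC).det := by
  set M := μ • (1 : Matrix (Bᶜ : Set V) (Bᶜ : Set V) ℂ) - (G.restrict Bᶜ).adjMatrixC with hM
  have h : IsUnit M.det := by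
    convert isUnit_det_of_notMem_spectrum _ hμ
  -- The order is dualized because the entry `(i, j)` belongs to an edge from `j` to `i`, while
  -- `BlockTriangular` wants it to vanish when `b j < b i`.
  let b : (Bᶜ : Set V) → (LinearExtension (Component G B))ᵒᵈ :=
    fun x => OrderDual.toDual (toLinearExtension (Component.of G x))
  have hb : M.BlockTriangular b := by
    intro i j hij
    by_contra hne
    have hne' : i ≠ j := by rintro rfl; exact lt_irrefl _ hij
    have hadj : G.Adj j i := by
      by_contra hadj
      exact hne (by simp [hM, hne', adjMatrixC, adjMatrix, restrict, hadj])
    have hle : Component.of G j ≤ Component.of G i := ⟨j, i, rfl, rfl, .single hadj⟩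
    have := toLinearExtension.monotone hle
    exact absurd hij (not_lt_of_ge (OrderDual.toDual_le_toDual.2 this))
  rw [hb.det, isUnit_iff_ne_zero, Finset.prod_ne_zero_iff] at h
  obtain ⟨x, rfl⟩ : ∃ x, Component.of G x = C := Quotient.exists_rep C
  have hx := h (b x) (Finset.mem_image_of_mem _ (Finset.mem_univ x))
  rw [isUnit_iff_ne_zero]
  let φ : (Component.of G x).verts ≃ {i // b i = b x} :=
    { toFun := fun y => ⟨⟨y, y.2.1⟩, congrArg (fun C => OrderDual.toDual (toLinearExtension C))
        (Component.of_eq y.2)⟩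
      invFun := fun y => ⟨y.1, by
        have : Component.of G y.1 = Component.of G x := y.2
        exact this ▸ Component.mem_verts_of y.1⟩
      left_inv := fun _ => rfl
      right_inv := fun _ => rfl }
  rw [← Matrix.det_submatrix_equiv_self φ] at hx
  convert hx using 2
  ext i j
  have : (φ i).1 = (φ j).1 ↔ i = j := by
    rw [← Subtype.ext_iff, φ.injective.eq_iff]
  simp [M, Matrix.toSquareBlock, Matrix.toSquareBlockProp, Matrix.one_apply, this,
    adjMatrixC, adjMatrix, restrict]
  rfl

theorem Component.resolvent_mul [Fintype V] {μ : ℂ} (hμ : μ ∉ (G.restrict Bᶜ).spectrum)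
    (C : Component G B) :
    C.resolvent μ * (μ • (1 : Matrix C.verts C.verts ℂ) - (G.restrict C.verts).adjMatrixC) = 1 :=
  Matrix.nonsing_inv_mul _ (C.isUnit_det hμ)

theorem Component.mul_resolvent [Fintype V] {μ : ℂ} (hμ : μ ∉ (G.restrict Bᶜ).spectrum)
    (C : Component G B) :
    (μ • (1 : Matrix C.verts C.verts ℂ) - (G.restrict C.verts).adjMatrixC) * C.resolvent μ = 1 :=
  Matrix.mul_nonsing_inv _ (C.isUnit_det hμ)

theorem sum_edgeBlock [Fintype V] (S T : Set V) (i : T) (j : S) :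
    (∑ e : {e : V × V // G.IsEdgeFromTo e S T}, G.edgeBlock S T e) i j = G.adjMatrixC i j := by
  simp only [Matrix.sum_apply, edgeBlock, Matrix.of_apply, adjMatrixC, adjMatrix, Matrix.map_apply]
  by_cases h : G.Adj j i
  · rw [if_pos h, Finset.sum_eq_single ⟨(j, i), h, j.2, i.2⟩]
    · simp
    · intro e _ he
      rw [if_neg]
      rintro h
      exact he (Subtype.ext h.symm)
    · simp
  · rw [if_neg h, Finset.sum_eq_zero]
    · simp
    · intro e _
      rw [if_neg]
      intro he
      have := e.2.1
      rw [← he] at this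
      exact h this

theorem edgeBlock_mulVec [Fintype V] {S T : Set V} {e : V × V} (h : e.1 ∈ S) (z : S → ℂ) (i : T) :
    (G.edgeBlock S T e).mulVec z i =
      if (i : V) = e.2 then (G.weight e.1 e.2 : ℂ) * z ⟨e.1, h⟩ else 0 := by
  simp only [Matrix.mulVec, dotProduct, edgeBlock, Matrix.of_apply]
  rw [Finset.sum_eq_single ⟨e.1, h⟩]
  · obtain ⟨a, b⟩ := e
    simp [ite_mul]
  · intro j _ hj
    rw [if_neg, zero_mul]
    rintro rfl
    exact hj rfl
  · simp

/-! ### Routes from the base and the expansion of `u_Z` -/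

variable (G B) in
/-- The routes through distinct consecutive components that lead from the base to a component. -/
inductive InRoute : Component G B → Type _
  | start {Z : Component G B} (e : V × V) (h : G.IsEdgeFromTo e B Z.verts) : InRoute Z
  | extend {D Z : Component G B} (r : InRoute D) (e : V × V) (hne : D ≠ Z)
      (h : G.IsEdgeFromTo e D.verts Z.verts) : InRoute Z

namespace InRoute

variable {Z : Component G B}

/-- The last edge of a route. -/
def entry : {Z : Component G B} → InRoute G B Z → V × V
  | _, start e _ => e
  | _, extend _ e _ _ => e

/-- The base vertex at which a route begins. -/
def first : {Z : Component G B} → InRoute G B Z → B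
  | _, start e h => ⟨e.1, h.2.1⟩
  | _, extend r _ _ _ => r.first

/-- All steps of a route but the last one, in reversed order. -/
def init : {Z : Component G B} → InRoute G B Z → List ((V × V) × Component G B)
  | _, start _ _ => []
  | _, extend (D := D) r _ _ _ => (r.entry, D) :: r.init

/-- A route is either a single edge or an edge preceded by a route. -/
def equivSum (Z : Component G B) : InRoute G B Z ≃
    {e : V × V // G.IsEdgeFromTo e B Z.verts} ⊕
      (D : {D : Component G B // D ≠ Z}) × InRoute G B D.1 ×
        {e : V × V // G.IsEdgeFromTo e D.1.verts Z.verts} where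
  toFun
    | start e h => .inl ⟨e, h⟩
    | extend (D := D) r e hne h => .inr ⟨⟨D, hne⟩, r, e, h⟩
  invFun
    | .inl e => start e.1 e.2
    | .inr p => extend p.2.1 p.2.2.1 p.1.2 p.2.2.2
  left_inv := by rintro (_ | _) <;> rfl
  right_inv := by rintro (_ | _) <;> rfl

/-- Routes have no length bound by definition; finiteness comes from the order, since a last edge
from `D ≠ Z` forces `D < Z`. -/
instance [Finite V] (Z : Component G B) : Finite (InRoute G B Z) := by
  induction Z using (wellFounded_lt (α := Component G B)).induction with
  | _ Z ih =>
    have : ∀ D : {D : Component G B // D ≠ Z}, Finite (InRoute G B D.1 ×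
        {e : V × V // G.IsEdgeFromTo e D.1.verts Z.verts}) := by
      intro D
      by_cases h : D.1 < Z
      · have := ih D.1 h
        infer_instance
      · have : IsEmpty {e : V × V // G.IsEdgeFromTo e D.1.verts Z.verts} :=
          ⟨fun e => h (lt_of_le_of_ne (Component.le_of_isEdgeFromTo e.2) D.2)⟩
        infer_instance
    exact Finite.of_equiv _ (equivSum Z).symm

noncomputable instance [Finite V] (Z : Component G B) : Fintype (InRoute G B Z) :=
  Fintype.ofFinite _

/-- The base vertex need not be compared: it is the tail of the first edge. -/
theorem ext_of_init_entry {Z : Component G B} {r s : InRoute G B Z} (hi : r.init = s.init)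
    (he : r.entry = s.entry) : r = s := by
  induction r with
  | start e h =>
    cases s with
    | start e' h' => cases he; rfl
    | extend s e' hne h' => simp [init] at hi
  | extend r e hne h ih =>
    cases s with
    | start e' h' => simp [init] at hi
    | extend s e' hne' h' =>
      simp only [init, List.cons.injEq, Prod.mk.injEq] at hi
      obtain ⟨⟨h1, rfl⟩, h2⟩ := hi
      cases he
      rw [ih h2 h1]

/-- The transfer product of a route applied to a vector on the base. -/
noncomputable def vec [Fintype V] (r : InRoute G B Z) (μ : ℂ) (w : B → ℂ) : Z.verts → ℂ :=
  (transferProd μ r.init r.entry Z).mulVec w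

/-- Splitting routes by their last edge turns the resolvent form of the eigenvector equation at `Z`
into a recursion over smaller components. -/
theorem sum_vec [Fintype V] {μ : ℂ} (hμ : μ ∉ (G.restrict Bᶜ).spectrum) {u : V → ℂ}
    (hu : G.adjMatrixC.mulVec u = μ • u) (Z : Component G B) :
    ∑ r : InRoute G B Z, r.vec μ (fun b => u b) = fun x : Z.verts => u x := by
  have : Fintype (Component G B) := Fintype.ofFinite _
  induction Z using (wellFounded_lt (α := Component G B)).induction with
  | _ Z ih =>
    have key : (μ • (1 : Matrix Z.verts Z.verts ℂ) - (G.restrict Z.verts).adjMatrixC).mulVec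
        (fun x : Z.verts => u x) =
        (∑ e : {e : V × V // G.IsEdgeFromTo e B Z.verts}, G.edgeBlock B Z.verts e).mulVec
          (fun b => u b) +
        ∑ D : {D : Component G B // D ≠ Z},
          (∑ e : {e : V × V // G.IsEdgeFromTo e D.1.verts Z.verts},
            G.edgeBlock D.1.verts Z.verts e).mulVec (fun x : D.1.verts => u x) := by
      ext i
      have h := congrFun hu i
      simp only [Matrix.mulVec, dotProduct] at h
      rw [sum_eq_sum_base_add_sum_component (G := G) (B := B),
        ← Finset.add_sum_erase _ _ (Finset.mem_univ Z)] at h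
      rw [Matrix.sub_mulVec, Matrix.smul_mulVec, Matrix.one_mulVec]
      simp only [Pi.sub_apply, Pi.add_apply, Finset.sum_apply, Pi.smul_apply]
      simp only [Matrix.mulVec, dotProduct, sum_edgeBlock]
      rw [sub_eq_iff_eq_add]
      simp only [Pi.smul_apply] at h
      rw [← h, add_comm (∑ x : Z.verts, _), ← add_assoc]
      congr 1
      congr 1
      rw [← Finset.sum_subtype (Finset.univ.erase Z) (by simp)
        (fun D : Component G B => ∑ x : D.verts, G.adjMatrixC i x * u x)]
    have hres := congrArg (Z.resolvent μ).mulVec key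
    rw [Matrix.mulVec_mulVec, Z.resolvent_mul hμ, Matrix.one_mulVec] at hres
    rw [hres, ← (equivSum Z).symm.sum_comp, Fintype.sum_sum_type, Matrix.mulVec_add,
      Fintype.sum_sigma, Matrix.sum_mulVec, Matrix.mulVec_sum, Matrix.mulVec_sum]
    congr 1
    · refine Finset.sum_congr rfl fun e _ => ?_
      rw [Matrix.mulVec_mulVec]
      rfl
    · refine Finset.sum_congr rfl fun D _ => ?_
      -- The edge is summed outermost: its existence is what gives `D < Z` and makes the induction
      -- hypothesis available.
      rw [Fintype.sum_prod_type_right, Matrix.sum_mulVec, Matrix.mulVec_sum]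
      refine Finset.sum_congr rfl fun e _ => ?_
      rw [← ih D.1 (lt_of_le_of_ne (Component.le_of_isEdgeFromTo e.2) D.2), Matrix.mulVec_sum,
        Matrix.mulVec_sum]
      refine Finset.sum_congr rfl fun r _ => ?_
      rw [Matrix.mulVec_mulVec, vec, vec, Matrix.mulVec_mulVec]
      rfl

end InRoute

/-! ### Cutting and joining branches at a component -/

theorem isRoute_append_cons {S T : Set V} {l l' : List ((V × V) × Component G B)}
    {f e : V × V} {C : Component G B} :
    G.IsRoute B S (l ++ (f, C) :: l') e T ↔
      G.IsRoute B S l f C.verts ∧ G.IsRoute B C.verts l' e T := by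
  induction l generalizing S with
  | nil => simp [IsRoute]
  | cons p l ih => obtain ⟨g, D⟩ := p; simp [IsRoute, ih, and_assoc]

/-- The components met after leaving `C` along a route are reachable from `C`, in order. -/
theorem IsRoute.pairwise_le {C : Component G B} {l : List ((V × V) × Component G B)}
    {e : V × V} {T : Set V} (h : G.IsRoute B C.verts l e T) :
    (C :: l.map Prod.snd).Pairwise (· ≤ ·) := by
  induction l generalizing C with
  | nil => simp
  | cons p l ih =>
    obtain ⟨g, D⟩ := p
    have h1 := ih h.2
    have hCD := Component.le_of_isEdgeFromTo h.1
    rw [List.map_cons, List.pairwise_cons]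
    refine ⟨?_, h1⟩
    intro E hE
    rcases List.mem_cons.1 hE with rfl | hE
    · exact hCD
    · exact hCD.trans (List.rel_of_pairwise_cons h1 hE)

namespace InRoute

variable {Z : Component G B}

theorem isRoute (r : InRoute G B Z) :
    G.IsRoute B {(r.first : V)} r.init.reverse r.entry Z.verts := by
  induction r with
  | start e h => exact ⟨h.1, rfl, h.2.2⟩
  | extend r e hne h ih =>
    simp only [init, List.reverse_cons]
    rw [isRoute_append_cons]
    exact ⟨ih, h⟩

/-- Consecutive components differ, so each step is strict in the order; hence all components of a
route are distinct. -/
theorem nodup_and_lt (r : InRoute G B Z) :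
    (r.init.map Prod.snd).Nodup ∧ ∀ C ∈ r.init.map Prod.snd, C < Z := by
  induction r with
  | start e h => simp [init]
  | @extend D Z r e hne h ih =>
    have hlt : D < Z := lt_of_le_of_ne (Component.le_of_isEdgeFromTo h) hne
    simp only [init, List.map_cons, List.nodup_cons, List.mem_cons]
    refine ⟨⟨fun hD => lt_irrefl _ (ih.2 _ hD), ih.1⟩, ?_⟩
    rintro C (rfl | hC)
    · exact hlt
    · exact (ih.2 C hC).trans hlt

theorem exists_of_isRoute {Z : Component G B} {l : List ((V × V) × Component G B)} {e : V × V}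
    {b : B} (h : G.IsRoute B {(b : V)} l.reverse e Z.verts)
    (hn : (Z :: l.map Prod.snd).Nodup) :
    ∃ r : InRoute G B Z, r.first = b ∧ r.init = l ∧ r.entry = e := by
  induction l generalizing Z e with
  | nil =>
    obtain ⟨h1, h2, h3⟩ := h
    have hB : e.1 ∈ B := Set.mem_singleton_iff.1 h2 ▸ b.2
    exact ⟨start e ⟨h1, hB, h3⟩, Subtype.ext h2, rfl, rfl⟩
  | cons p l ih =>
    obtain ⟨f, D⟩ := p
    rw [List.reverse_cons, isRoute_append_cons] at h
    rw [List.map_cons, List.nodup_cons] at hn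
    obtain ⟨r, h1, h2, h3⟩ := ih h.1 hn.2
    have hne : D ≠ Z := by
      rintro rfl
      exact hn.1 List.mem_cons_self
    exact ⟨r.extend e hne h.2, h1, by simp [init, h2, h3], rfl⟩

/-- The branch that follows a route to `Z` and then a route from `Z` to the base. -/
def toBranch (r : InRoute G B Z) {rest : List ((V × V) × Component G B)} {e : V × V} {b : B}
    (h : G.IsRoute B Z.verts rest e {(b : V)}) (hn : (Z :: rest.map Prod.snd).Nodup) :
    ComponentBranch G B where
  first := r.first
  steps := r.init.reverse ++ (r.entry, Z) :: rest
  exitEdge := e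
  last := b
  isRoute := isRoute_append_cons.2 ⟨r.isRoute, h⟩
  nodup := by
    obtain ⟨h1, h2⟩ := r.nodup_and_lt
    rw [List.map_append, List.map_reverse, List.map_cons, List.nodup_append]
    -- Components before `Z` are `< Z`, while `Z` and those after it are `≥ Z`, so the two halves
    -- share none.
    refine ⟨List.nodup_reverse.2 h1, hn, ?_⟩
    intro C hC D hD
    have hCZ := h2 C (List.mem_reverse.1 hC)
    rcases List.mem_cons.1 hD with rfl | hD
    · exact hCZ.ne
    · exact (hCZ.trans_le (List.rel_of_pairwise_cons h.pairwise_le hD)).ne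

end InRoute

namespace ComponentBranch

variable {β : ComponentBranch G B} {Z : Component G B} {l rest : List ((V × V) × Component G B)}
  {e : V × V}

theorem exists_steps_eq (hZ : Z ∈ β.comps) : ∃ l e rest, β.steps = l ++ (e, Z) :: rest := by
  obtain ⟨⟨e, C⟩, hp, rfl⟩ := List.mem_map.1 hZ
  obtain ⟨l, rest, h⟩ := List.append_of_mem hp
  exact ⟨l, e, rest, h⟩

theorem mem_comps_of_steps_eq (h : β.steps = l ++ (e, Z) :: rest) : Z ∈ β.comps := by
  simp [comps, h]

theorem pos_eq (h : β.steps = l ++ (e, Z) :: rest) : β.pos Z = l.length := by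
  have hn := β.nodup
  rw [h, List.map_append, List.map_cons, List.nodup_append] at hn
  have hZ : Z ∉ l.map Prod.snd := fun hZ => hn.2.2 Z hZ Z List.mem_cons_self rfl
  rw [pos, comps, h, List.map_append, List.idxOf_append_of_notMem hZ]
  simp

theorem transferMatrix_eq [Fintype V] (h : β.steps = l ++ (e, Z) :: rest) (hZ : Z ∈ β.comps)
    (μ : ℂ) : β.transferMatrix Z hZ μ = transferProd μ l.reverse e Z := by
  have he : β.entryEdge Z hZ = e := by
    simp [entryEdge, pos_eq h, h]
  rw [transferMatrix, he, pos_eq h, h, List.take_left]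

theorem outgoing_eq (h : β.steps = l ++ (e, Z) :: rest) :
    β.outgoing Z = (Z, rest, β.exitEdge, β.last) := by
  rw [outgoing, pos_eq h, h]
  simp

theorem transferMatrix_congr [Fintype V] {β γ : ComponentBranch G B} (hβ : Z ∈ β.comps)
    (hγ : Z ∈ γ.comps) (h : β.incoming Z = γ.incoming Z) (μ : ℂ) :
    β.transferMatrix Z hβ μ = γ.transferMatrix Z hγ μ := by
  obtain ⟨l, e, rest, h1⟩ := exists_steps_eq hβ
  obtain ⟨l', e', rest', h2⟩ := exists_steps_eq hγ
  rw [transferMatrix_eq h1, transferMatrix_eq h2]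
  rw [incoming, incoming, pos_eq h1, pos_eq h2, h1, h2] at h
  simp only [List.take_length_add_append, List.take_succ_cons, List.take_zero, Prod.mk.injEq] at h
  -- Both lists end in a one-element tail, so the prefixes can be matched without knowing their
  -- lengths.
  obtain ⟨rfl, h3⟩ := List.append_inj' h.2 rfl
  simp only [List.cons.injEq, Prod.mk.injEq, and_true] at h3
  rw [h3]

/-- Routes into `Z` correspond to the copies of `Z` with a prescribed outgoing branch. -/
theorem sum_outgoing_eq_sum_inRoute [Fintype V] {b : B}
    (h : G.IsRoute B Z.verts rest e {(b : V)}) (hn : (Z :: rest.map Prod.snd).Nodup) (μ : ℂ)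
    (w : B → ℂ) :
    ∑ Zk : Copy Z with Zk.1.outgoing Z = (Z, rest, e, b),
      (Zk.1.transferMatrix Z Zk.2 μ).mulVec w = ∑ r : InRoute G B Z, r.vec μ w := by
  symm
  refine Finset.sum_bij (fun r _ => ⟨r.toBranch h hn, mem_comps_of_steps_eq (e := r.entry) rfl⟩)
    ?_ ?_ ?_ ?_
  · intro r _
    exact Finset.mem_filter.2 ⟨Finset.mem_univ _, outgoing_eq (e := r.entry) rfl⟩
  · intro r _ s _ hrs
    have hrs' := congrArg (fun c : Copy Z => c.1.steps) hrs
    obtain ⟨h1, h2⟩ := List.append_inj' hrs' rfl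
    simp only [List.cons.injEq, Prod.mk.injEq, and_true] at h2
    exact InRoute.ext_of_init_entry (List.reverse_injective h1) h2
  · intro Zk hk
    obtain ⟨l, f, rest', h1⟩ := exists_steps_eq Zk.2
    have h2 := (Finset.mem_filter.1 hk).2
    rw [outgoing_eq h1] at h2
    simp only [Prod.mk.injEq, true_and] at h2
    obtain ⟨rfl, rfl, rfl⟩ := h2
    have h3 := Zk.1.isRoute
    rw [h1, isRoute_append_cons] at h3
    have h4 := Zk.1.nodup
    rw [h1, List.map_append, List.map_cons, List.nodup_append] at h4
    obtain ⟨r, hr1, hr2, hr3⟩ := InRoute.exists_of_isRoute (l := l.reverse)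
      (by simpa using h3.1) (by
        rw [List.nodup_cons, List.map_reverse, List.nodup_reverse, List.mem_reverse]
        exact ⟨fun hZ => h4.2.2 Z hZ Z List.mem_cons_self rfl, h4.1⟩)
    refine ⟨r, Finset.mem_univ _, Subtype.ext (ComponentBranch.ext hr1 ?_ rfl rfl)⟩
    simp [InRoute.toBranch, hr2, hr3, h1]
  · intro r _
    rw [InRoute.vec, transferMatrix_eq (l := r.init.reverse) (e := r.entry) (rest := rest) rfl,
      List.reverse_reverse]

end ComponentBranch

/-! ### Edges of a branch and of the specialization -/

/-- One branch holds at most one copy of each vertex, so adjacency within it can be checked in `G`.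
-/
theorem SpecVertex.eq_of_liesOn {β : ComponentBranch G B} {x y : SpecVertex G B}
    (hx : x.LiesOn β) (hy : y.LiesOn β) (h : x.orig = y.orig) : x = y := by
  rcases x with x | ⟨⟨γ, x⟩, C, hC, hxC⟩ <;> rcases y with y | ⟨⟨δ, y⟩, D, hD, hyD⟩
  · exact congrArg _ (Subtype.ext h)
  · exact absurd (show y ∈ B from (show (x : V) = y from h) ▸ x.2) hyD.1
  · exact absurd (show x ∈ B from (show x = (y : V) from h) ▸ y.2) hxC.1
  · obtain rfl : γ = β := hx
    obtain rfl : δ = γ := hy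
    obtain rfl : x = y := h
    rfl

/-- Every edge of a route leads to the component it is listed with. -/
theorem IsRoute.mem_verts {S T : Set V} {l : List ((V × V) × Component G B)} {e f : V × V}
    {C : Component G B} (h : G.IsRoute B S l e T) (hf : (f, C) ∈ l) :
    G.Adj f.1 f.2 ∧ f.2 ∈ C.verts := by
  obtain ⟨l₁, l₂, rfl⟩ := List.append_of_mem hf
  rw [isRoute_append_cons] at h
  have := h.1
  clear h hf
  induction l₁ generalizing S with
  | nil => exact ⟨this.1, this.2.2⟩
  | cons p l₁ ih => obtain ⟨g, D⟩ := p; exact ih this.2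

theorem IsRoute.exit {S T : Set V} {l : List ((V × V) × Component G B)} {e : V × V}
    (h : G.IsRoute B S l e T) : G.Adj e.1 e.2 ∧ e.2 ∈ T := by
  induction l generalizing S with
  | nil => exact ⟨h.1, h.2.2⟩
  | cons p l ih => obtain ⟨g, D⟩ := p; exact ih h.2

namespace ComponentBranch

variable {β : ComponentBranch G B} {Z : Component G B} {l rest : List ((V × V) × Component G B)}
  {e : V × V}

theorem exitEdge_snd (β : ComponentBranch G B) : β.exitEdge.2 = β.last := β.isRoute.exit.2

theorem adj_exitEdge (β : ComponentBranch G B) : G.Adj β.exitEdge.1 β.exitEdge.2 :=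
  β.isRoute.exit.1

/-- Each listed edge ends in the component listed with it, `Z` is listed once, and the exit edge
ends in `B`; so `e` is the only connecting edge into `Z`. -/
theorem adj_iff_of_mem_verts (h : β.steps = l ++ (e, Z) :: rest) {x y : V} (hy : y ∈ Z.verts) :
    β.Adj x y ↔ (x ∈ Z.verts ∧ G.Adj x y) ∨ (x, y) = e := by
  constructor
  · rintro (hxy | ⟨C, hC, hx, hy', hadj⟩)
    · right
      rcases List.mem_append.1 hxy with hxy | hxy
      · obtain ⟨⟨f, C⟩, hf, hfe⟩ := List.mem_map.1 hxy
        obtain rfl : f = (x, y) := hfe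
        obtain rfl := Component.eq_of_mem_verts (β.isRoute.mem_verts hf).2 hy
        exact congrArg Prod.fst (List.inj_on_of_nodup_map β.nodup hf
          (show (e, C) ∈ β.steps by simp [h]) rfl)
      · have h1 := β.exitEdge_snd
        rw [← List.mem_singleton.1 hxy] at h1
        exact absurd (show y ∈ B from (show y = β.last from h1) ▸ β.last.2) hy.1
    · obtain rfl := Component.eq_of_mem_verts hy hy'
      exact .inl ⟨hx, hadj⟩
  · rintro (⟨hx, hadj⟩ | rfl)
    · exact .inr ⟨Z, mem_comps_of_steps_eq h, hx, hy, hadj⟩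
    · exact .inl (by simp [edges, h])

theorem adj_iff_of_mem_base (β : ComponentBranch G B) {x y : V} (hy : y ∈ B) :
    β.Adj x y ↔ (x, y) = β.exitEdge := by
  constructor
  · rintro (hxy | ⟨C, hC, hx, hy', hadj⟩)
    · rcases List.mem_append.1 hxy with hxy | hxy
      · obtain ⟨⟨f, C⟩, hf, hfe⟩ := List.mem_map.1 hxy
        obtain rfl : f = (x, y) := hfe
        exact absurd hy (β.isRoute.mem_verts hf).2.1
      · exact List.mem_singleton.1 hxy
    · exact absurd hy hy'.1
  · intro h
    exact .inl (by simp [edges, h])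

/-- If the exit edge of a branch leaves `Z`, then `Z` is the last component of the branch. -/
theorem steps_eq_of_exitEdge_fst_mem (β : ComponentBranch G B) (h : β.exitEdge.1 ∈ Z.verts) :
    ∃ l e, β.steps = l ++ [(e, Z)] := by
  have h2 := β.isRoute
  rcases List.eq_nil_or_concat' β.steps with h1 | ⟨l, ⟨f, C⟩, h1⟩
  · rw [h1] at h2
    exact absurd (show β.exitEdge.1 ∈ B from Set.mem_singleton_iff.1 h2.2.1 ▸ β.first.2) h.1
  · rw [h1, isRoute_append_cons] at h2
    obtain rfl := Component.eq_of_mem_verts h2.2.2.1 h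
    exact ⟨l, f, h1⟩

end ComponentBranch

/-! ### The eigenvector of the specialization -/

/-- The vector on the specialized graph that extends `w` by the transfer matrices. -/
noncomputable def specVec [Fintype V] (G : WDigraph V) (B : Set V) (μ : ℂ) (w : B → ℂ) :
    SpecVertex G B → ℂ
  | .inl b => w b
  | .inr p => (p.1.1.transferMatrix p.2.choose p.2.choose_spec.1 μ).mulVec w
      ⟨p.1.2, p.2.choose_spec.2⟩

/-- Components are disjoint, so the one picked by `choose` can only be `Z`. -/
theorem specVec_vertex [Fintype V] (μ : ℂ) (w : B → ℂ) {Z : Component G B} (Zi : Copy Z)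
    (x : Z.verts) :
    G.specVec B μ w (Zi.vertex x) = (Zi.1.transferMatrix Z Zi.2 μ).mulVec w x := by
  have key : ∀ (C : Component G B) (hC : C ∈ Zi.1.comps) (hx : (x : V) ∈ C.verts),
      (Zi.1.transferMatrix C hC μ).mulVec w ⟨x, hx⟩ =
        (Zi.1.transferMatrix Z Zi.2 μ).mulVec w x := by
    intro C hC hx
    obtain rfl := Component.eq_of_mem_verts hx x.2
    rfl
  exact key _ _ _

theorem sum_specVertex [Fintype V] [Fintype (SpecVertex G B)] [Fintype (Component G B)]
    {M : Type*} [AddCommMonoid M] (f : SpecVertex G B → M) :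
    ∑ y, f y = ∑ b : B, f (.inl b) + ∑ Z : Component G B, ∑ x : Z.verts, ∑ Zi : Copy Z,
      f (Zi.vertex x) := by
  have h0 : Fintype {p : ComponentBranch G B × V // ∃ C ∈ p.1.comps, p.2 ∈ C.verts} :=
    Fintype.ofFinite _
  have h1 : ∑ y, f y = ∑ b : B, f (.inl b) + ∑ p, f (.inr p) := by
    rw [← Fintype.sum_sum_type]
    congr!
  rw [h1]
  congr 1
  simp only [← Fintype.sum_prod_type']
  rw [← Fintype.sum_sigma' (fun (Z : Component G B) (p : Z.verts × Copy Z) => f (p.2.vertex p.1))]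
  symm
  refine Fintype.sum_bijective
    (fun p : (Z : Component G B) × Z.verts × Copy Z =>
      ⟨(p.2.2.1, p.2.1), p.1, p.2.2.2, p.2.1.2⟩) ⟨?_, ?_⟩ _ _ fun _ => rfl
  · rintro ⟨C, ⟨x, hx⟩, ⟨β, hβ⟩⟩ ⟨D, ⟨y, hy⟩, ⟨γ, hγ⟩⟩ h
    simp only [Subtype.mk.injEq, Prod.mk.injEq] at h
    obtain ⟨rfl, rfl⟩ := h
    obtain rfl := Component.eq_of_mem_verts hx hy
    rfl
  · rintro ⟨⟨β, x⟩, Z, hZ, hx⟩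
    exact ⟨⟨Z, ⟨x, hx⟩, ⟨β, hZ⟩⟩, rfl⟩

theorem sum_adjMatrixC_vertex [Fintype V] [Fintype (SpecVertex G B)] {μ : ℂ}
    (hμ : μ ∉ (G.restrict Bᶜ).spectrum) (w : B → ℂ) {Z : Component G B} (Zi : Copy Z)
    (x : Z.verts) :
    ∑ y, (G.specialization B).adjMatrixC (Zi.vertex x) y * G.specVec B μ w y =
      μ * G.specVec B μ w (Zi.vertex x) := by
  obtain ⟨β, hZ⟩ := Zi
  obtain ⟨l, e, rest, hs⟩ := ComponentBranch.exists_steps_eq hZ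
  have hroute := β.isRoute
  rw [hs, isRoute_append_cons] at hroute
  -- `s` is the tail of the entry edge: a base vertex if `Z` comes first in `β`, otherwise a vertex
  -- of the preceding component's copy in `β`.
  obtain ⟨s, hsβ, hso, hsZ, hT⟩ : ∃ s : SpecVertex G B, s.LiesOn β ∧ s.orig = e.1 ∧
      e.1 ∉ Z.verts ∧
      (μ • (1 : Matrix Z.verts Z.verts ℂ) - (G.restrict Z.verts).adjMatrixC).mulVec
        ((β.transferMatrix Z hZ μ).mulVec w) = fun i : Z.verts =>
          if (i : V) = e.2 then (G.weight e.1 e.2 : ℂ) * G.specVec B μ w s else 0 := by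
    rw [ComponentBranch.transferMatrix_eq hs]
    rcases List.eq_nil_or_concat' l with rfl | ⟨l', ⟨f, D⟩, rfl⟩
    · have he : e.1 ∈ B := Set.mem_singleton_iff.1 hroute.1.2.1 ▸ β.first.2
      refine ⟨.inl ⟨e.1, he⟩, trivial, rfl, fun h => h.1 he, ?_⟩
      rw [List.reverse_nil, transferProd, Matrix.mulVec_mulVec, ← Matrix.mul_assoc,
        Z.mul_resolvent hμ, Matrix.one_mul]
      ext i
      rw [edgeBlock_mulVec he]
      rfl
    · have hs' : β.steps = l' ++ (f, D) :: (e, Z) :: rest := by simp [hs]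
      have hD := ComponentBranch.mem_comps_of_steps_eq hs'
      have h1 := hroute.1
      rw [isRoute_append_cons] at h1
      have he : e.1 ∈ D.verts := h1.2.2.1
      refine ⟨Copy.vertex (Z := D) ⟨β, hD⟩ ⟨e.1, he⟩, rfl, rfl, ?_, ?_⟩
      · intro he'
        obtain rfl := Component.eq_of_mem_verts he he'
        have hn := β.nodup
        rw [hs'] at hn
        simp [List.nodup_append] at hn
      · rw [List.reverse_append, List.reverse_singleton, List.singleton_append, transferProd,
          Matrix.mulVec_mulVec, ← Matrix.mul_assoc, ← Matrix.mul_assoc,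
          Z.mul_resolvent hμ, Matrix.one_mul, ← Matrix.mulVec_mulVec]
        ext i
        rw [edgeBlock_mulVec he, specVec_vertex, ComponentBranch.transferMatrix_eq hs']
  have hTx := congrFun hT x
  rw [Matrix.sub_mulVec, Matrix.smul_mulVec, Matrix.one_mulVec, Pi.sub_apply, Pi.smul_apply,
    smul_eq_mul, sub_eq_iff_eq_add] at hTx
  rw [specVec_vertex, hTx]
  have hadj : ∀ y : SpecVertex G B, (G.specialization B).Adj y (Copy.vertex ⟨β, hZ⟩ x) ↔
      (∃ y' : Z.verts, Copy.vertex ⟨β, hZ⟩ y' = y ∧ G.Adj y' x) ∨ (y = s ∧ (x : V) = e.2) := by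
    intro y
    constructor
    · rintro ⟨γ, hy, hγ, hadj⟩
      obtain rfl : β = γ := hγ
      rcases (ComponentBranch.adj_iff_of_mem_verts hs x.2).1 hadj with ⟨h1, h2⟩ | h1
      · exact .inl ⟨⟨y.orig, h1⟩, SpecVertex.eq_of_liesOn rfl hy rfl, h2⟩
      · exact .inr ⟨SpecVertex.eq_of_liesOn hy hsβ (by rw [hso, ← h1]), congrArg Prod.snd h1⟩
    · rintro (⟨y', rfl, h⟩ | ⟨rfl, h⟩)
      · exact ⟨β, rfl, rfl, (ComponentBranch.adj_iff_of_mem_verts hs x.2).2 (.inl ⟨y'.2, h⟩)⟩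
      · exact ⟨β, hsβ, rfl, (ComponentBranch.adj_iff_of_mem_verts hs x.2).2
          (.inr (Prod.ext hso h))⟩
  have hinj : Function.Injective (fun y : Z.verts => Copy.vertex (⟨β, hZ⟩ : Copy Z) y) := by
    intro a b hab
    exact Subtype.ext (congrArg SpecVertex.orig hab)
  -- The two terms have disjoint supports, as `s` lies outside this copy of `Z`.
  have hsplit : ∀ y : SpecVertex G B,
      (G.specialization B).adjMatrixC (Copy.vertex ⟨β, hZ⟩ x) y * G.specVec B μ w y =
      (if y = s then (if (x : V) = e.2 then (G.weight e.1 e.2 : ℂ) * G.specVec B μ w s else 0)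
        else 0) +
      ∑ y' : Z.verts, if Copy.vertex ⟨β, hZ⟩ y' = y then
        (G.restrict Z.verts).adjMatrixC x y' * (β.transferMatrix Z hZ μ).mulVec w y' else 0 := by
    intro y
    by_cases h1 : ∃ y' : Z.verts, Copy.vertex ⟨β, hZ⟩ y' = y
    · obtain ⟨y', rfl⟩ := h1
      have hne : Copy.vertex ⟨β, hZ⟩ y' ≠ s := by
        rintro rfl
        exact hsZ (hso ▸ y'.2)
      have h2 : (G.specialization B).Adj (Copy.vertex ⟨β, hZ⟩ y') (Copy.vertex ⟨β, hZ⟩ x) ↔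
          G.Adj y' x := by
        rw [hadj]
        constructor
        · rintro (⟨a, ha, h⟩ | ⟨h, -⟩)
          · rwa [← hinj ha]
          · exact absurd h hne
        · exact fun h => .inl ⟨y', rfl, h⟩
      rw [if_neg hne, zero_add, Finset.sum_eq_single y', if_pos rfl, specVec_vertex]
      · congr 1
        simp only [adjMatrixC, adjMatrix, Matrix.map_apply, Matrix.of_apply, h2]
        rfl
      · exact fun a _ ha => if_neg fun h => ha (hinj h)
      · simp
    · rw [Finset.sum_eq_zero (fun a _ => if_neg fun h => h1 ⟨a, h⟩), add_zero]
      by_cases h2 : y = s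
      · subst h2
        have h3 : (G.specialization B).Adj y (Copy.vertex ⟨β, hZ⟩ x) ↔ (x : V) = e.2 := by
          rw [hadj]
          constructor
          · rintro (⟨a, ha, h⟩ | ⟨-, h⟩)
            · exact absurd ⟨a, ha⟩ h1
            · exact h
          · exact fun h => .inr ⟨rfl, h⟩
        simp only [adjMatrixC, adjMatrix, Matrix.map_apply, Matrix.of_apply, h3, if_true]
        split_ifs with h4
        · rw [← hso, ← h4]
          rfl
        · simp
      · have h3 : ¬ (G.specialization B).Adj y (Copy.vertex ⟨β, hZ⟩ x) := by
          rw [hadj]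
          rintro (⟨a, ha, h⟩ | ⟨h, -⟩)
          · exact h1 ⟨a, ha⟩
          · exact h2 h
        simp [adjMatrixC, adjMatrix, h3, h2]
  rw [Finset.sum_congr rfl fun y _ => hsplit y, Finset.sum_add_distrib, Finset.sum_comm]
  simp [Matrix.mulVec, dotProduct]

theorem sum_adjMatrixC_inl [Fintype V] [Fintype (SpecVertex G B)] {μ : ℂ}
    (hμ : μ ∉ (G.restrict Bᶜ).spectrum) {u : V → ℂ} (hu : G.adjMatrixC.mulVec u = μ • u) (b : B) :
    ∑ y, (G.specialization B).adjMatrixC (.inl b) y * G.specVec B μ (fun b => u b) y =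
      μ * u b := by
  have : Fintype (Component G B) := Fintype.ofFinite _
  have h := congrFun hu b
  simp only [Matrix.mulVec, dotProduct, Pi.smul_apply, smul_eq_mul] at h
  rw [sum_specVertex, ← h, sum_eq_sum_base_add_sum_component (G := G) (B := B)]
  congr 1
  · refine Finset.sum_congr rfl fun b' _ => ?_
    have h1 : (G.specialization B).Adj (.inl b') (.inl b) ↔ G.Adj b' b := by
      constructor
      · rintro ⟨β, -, -, hadj⟩
        have := (β.adj_iff_of_mem_base b.2).1 hadj
        have h2 := β.adj_exitEdge
        rw [← this] at h2
        exact h2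
      · intro hadj
        -- An edge inside `B` is itself a branch with `m = 0`.
        exact ⟨⟨b', [], (b', b), b, ⟨hadj, rfl, rfl⟩, List.nodup_nil⟩, trivial, trivial,
          (ComponentBranch.adj_iff_of_mem_base _ b.2).2 rfl⟩
    simp only [adjMatrixC, adjMatrix, Matrix.map_apply, Matrix.of_apply, h1]
    rfl
  · refine Finset.sum_congr rfl fun Z _ => Finset.sum_congr rfl fun x _ => ?_
    -- The copies of `x` adjacent to `b` are those in copies of `Z` with outgoing branch the bare
    -- edge `(x, b)`, which is a class to which the sum formula applies.
    have h1 : ∀ Zi : Copy Z, (G.specialization B).Adj (Zi.vertex x) (.inl b) ↔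
        G.Adj x b ∧ Zi.1.outgoing Z = (Z, [], ((x : V), (b : V)), b) := by
      intro Zi
      constructor
      · rintro ⟨β, hβ, -, hadj⟩
        obtain rfl : Zi.1 = β := hβ
        have h2 : ((x : V), (b : V)) = Zi.1.exitEdge := (Zi.1.adj_iff_of_mem_base b.2).1 hadj
        have h3 := Zi.1.adj_exitEdge
        rw [← h2] at h3
        obtain ⟨l, e, hs⟩ := Zi.1.steps_eq_of_exitEdge_fst_mem (Z := Z) (h2 ▸ x.2)
        refine ⟨h3, ?_⟩
        rw [ComponentBranch.outgoing_eq hs, ← h2]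
        have h4 := Zi.1.exitEdge_snd
        rw [← h2] at h4
        rw [show Zi.1.last = b from (Subtype.ext h4).symm]
      · rintro ⟨hadj, h2⟩
        refine ⟨Zi.1, rfl, trivial, (Zi.1.adj_iff_of_mem_base b.2).2 ?_⟩
        simp only [ComponentBranch.outgoing, Prod.mk.injEq] at h2
        exact h2.2.2.1.symm
    by_cases hadj : G.Adj x b
    · have hr : G.IsRoute B Z.verts [] ((x : V), (b : V)) {(b : V)} := ⟨hadj, x.2, rfl⟩
      have h2 := congrFun ((ComponentBranch.sum_outgoing_eq_sum_inRoute hr (by simp) μ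
        (fun b => u b)).trans (InRoute.sum_vec hμ hu Z)) x
      rw [Finset.sum_apply] at h2
      rw [← h2, Finset.mul_sum, Finset.sum_filter]
      refine Finset.sum_congr rfl fun Zi _ => ?_
      rw [specVec_vertex]
      simp only [adjMatrixC, adjMatrix, Matrix.map_apply, Matrix.of_apply, h1, hadj, true_and]
      split_ifs
      · rfl
      · simp
    · simp [adjMatrixC, adjMatrix, h1, hadj]

/-- By `InRoute.sum_vec`, `u` outside `B` depends linearly on `u_B`. -/
theorem exists_base_ne_zero [Fintype V] {μ : ℂ} (hμ : μ ∉ (G.restrict Bᶜ).spectrum) {u : V → ℂ}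
    (hu : G.IsEigenpair μ u) : ∃ b : B, u b ≠ 0 := by
  by_contra! h
  have hw : (fun b : B => u b) = 0 := funext h
  refine hu.1 (funext fun x => ?_)
  by_cases hx : x ∈ B
  · exact h ⟨x, hx⟩
  · have h1 := congrFun (InRoute.sum_vec hμ hu.2 (Component.of G ⟨x, hx⟩))
      ⟨x, Component.mem_verts_of _⟩
    rw [hw] at h1
    simpa [InRoute.vec] using h1.symm

end TransferVectors

end WDigraph

/-! ### The theorem on eigenvectors of specialized graphs -/

theorem theorem2 {V : Type*} [Fintype V] (G : WDigraph V) (B : Set V) (μ : ℂ) (u : V → ℂ)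
    (hu : G.IsEigenpair μ u) (hμ : μ ∉ (G.restrict Bᶜ).spectrum) :
    ∃ v : WDigraph.SpecVertex G B → ℂ, (G.specialization B).IsEigenpair μ v ∧
      -- agreement on the base
      (∀ b : B, u b = v (.inl b)) ∧
      ∀ Z : WDigraph.Component G B,
        -- every copy is obtained from the base by its transfer matrix
        (∀ Zi : WDigraph.Copy Z,
          (fun x : Z.verts => v (Zi.vertex x)) =
            (Zi.1.transferMatrix Z Zi.2 μ).mulVec (fun b : B => v (.inl b))) ∧
        -- copies with the same incoming branch carry equal entries
        (∀ Zi Zj : WDigraph.Copy Z, Zi.1.incoming Z = Zj.1.incoming Z →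
          (fun x : Z.verts => v (Zi.vertex x)) = fun x : Z.verts => v (Zj.vertex x)) ∧
        -- sums over the copies with the same outgoing branch
        (∀ Zi : WDigraph.Copy Z,
          ((fun x : Z.verts => u x) =
            ∑ Zk : WDigraph.Copy Z with Zk.1.outgoing Z = Zi.1.outgoing Z,
              fun x : Z.verts => v (Zk.vertex x)) ∧
          ((fun x : Z.verts => u x) =
            ∑ Zk : WDigraph.Copy Z with Zk.1.outgoing Z = Zi.1.outgoing Z,
              (Zk.1.transferMatrix Z Zk.2 μ).mulVec (fun b : B => v (.inl b)))) := by
  have hval : ∀ (Z : WDigraph.Component G B) (Zi : WDigraph.Copy Z),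
      (fun x : Z.verts => G.specVec B μ (fun b => u b) (Zi.vertex x)) =
        (Zi.1.transferMatrix Z Zi.2 μ).mulVec (fun b : B => u b) :=
    fun Z Zi => funext fun x => WDigraph.specVec_vertex μ _ Zi x
  have hsum : ∀ (Z : WDigraph.Component G B) (Zi : WDigraph.Copy Z),
      (fun x : Z.verts => u x) =
        ∑ Zk : WDigraph.Copy Z with Zk.1.outgoing Z = Zi.1.outgoing Z,
          (Zk.1.transferMatrix Z Zk.2 μ).mulVec (fun b : B => u b) := by
    intro Z Zi
    obtain ⟨l, e, rest, hs⟩ := WDigraph.ComponentBranch.exists_steps_eq Zi.2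
    have hr := Zi.1.isRoute
    have hn := Zi.1.nodup
    rw [hs, WDigraph.isRoute_append_cons] at hr
    rw [hs, List.map_append, List.map_cons, List.nodup_append] at hn
    rw [WDigraph.ComponentBranch.outgoing_eq hs,
      WDigraph.ComponentBranch.sum_outgoing_eq_sum_inRoute hr.2 hn.2.1]
    exact (WDigraph.InRoute.sum_vec hμ hu.2 Z).symm
  refine ⟨G.specVec B μ fun b => u b, ⟨?_, ?_⟩, fun b => rfl, fun Z => ⟨hval Z, ?_, ?_⟩⟩
  · obtain ⟨b, hb⟩ := WDigraph.exists_base_ne_zero hμ hu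
    exact fun h => hb (congrFun h (.inl b))
  · ext y
    rcases y with b | ⟨⟨β, x⟩, Z, hZ, hx⟩
    · exact WDigraph.sum_adjMatrixC_inl hμ hu.2 b
    · exact WDigraph.sum_adjMatrixC_vertex hμ _ (⟨β, hZ⟩ : WDigraph.Copy Z) ⟨x, hx⟩
  · intro Zi Zj h
    rw [hval, hval, WDigraph.ComponentBranch.transferMatrix_congr Zi.2 Zj.2 h]
  · intro Zi
    refine ⟨?_, hsum Z Zi⟩
    rw [hsum Z Zi]
    exact Finset.sum_congr rfl fun Zk _ => (hval Z Zk).symm
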